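/- Let $\mathcal B$ and $\mathcal C$ be real Banach spaces and let $f:\mathcal B\to\mathbb R$ be convex and lower semicontinuous. For $i=1,\dots,m$ let $U_i\subset\mathcal C$ be nonempty, convex and weakly compact, and let $g_i:\mathcal B\times\mathcal C\to\mathbb R$ be such that $g_i(x,\cdot)\in\mathcal C^*$ (linear and continuous) for every $x\in\mathcal B$, and $g_i(\cdot,u_i)$ is convex and continuous for every $u_i\in U_i$. Consider the robust counterpart $$(\mathrm{R\text{-}P})\qquad \inf_{x\in\mathcal B}\Big\{f(x):\ \sup_{u_i\in U_i} g_i(x,u_i)\le 0,\ i=1,\dots,m\Big\}$$ and assume the Slater condition: there is $x_0\in\mathcal B$ with $\sup_{u_i\in U_i}g_i(x_0,u_i)<0$ for $i=1,\dots,m$. For $h:\mathcal B\to\mathbb R$ write $\partial h(x)=\{x^*\in\mathcal B^*: h(y)\ge h(x)+\langle y-x,x^*\rangle\ \ \forall y\in\mathcal B\}$, and let $\partial_x g_i(\bar x,\bar u_i)$ be the subdifferential of $g_i(\cdot,\bar u_i)$ at $\bar x$. Then a point $\bar x\in\mathcal B$ is a minimizer of $(\mathrm{R\text{-}P})$ if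 and only if there exist $\bar\lambda\in\mathbb R_+^m$ and $\bar u\in\prod_{i=1}^m U_i$ such that $$\sup_{u_i\in U_i} g_i(\bar x,u_i)\le 0,\quad i=1,\dots,m,$$ $$0\in\partial f(\bar x)+\sum_{i=1}^m\bar\lambda_i\,\partial_x g_i(\bar x,\bar u_i),$$ $$\bar\lambda_i\,g_i(\bar x,\bar u_i)=0,\quad i=1,\dots,m.$$ -/

import Mathlib

open scoped Pointwise

/-- The Fenchel subdifferential of a real-valued function `h` at `x`: the set of all continuous
linear functionals `s` with `h y ≥ h x + ⟨y - x, s⟩` for every `y`. -/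
def fenchelSubdifferential {E : Type*} [NormedAddCommGroup E] [NormedSpace ℝ E]
    (h : E → ℝ) (x : E) : Set (StrongDual ℝ E) :=
  {s | ∀ y : E, h x + s (y - x) ≤ h y}

/-- A subset of a normed space is weakly compact if it is compact in the weak topology. -/
def IsWeaklyCompact {E : Type*} [NormedAddCommGroup E] [NormedSpace ℝ E] (K : Set E) : Prop :=
  IsCompact (toWeakSpace ℝ E '' K)

/-- The worst-case function `x ↦ sup_{u ∈ U} g(x, u)`. The supremum is taken in `ℝ`; it is a genuine
supremum for nonempty weakly compact `U`, see `isLUB_worstCase`. -/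
noncomputable def worstCase {B C : Type*} [NormedAddCommGroup C] [NormedSpace ℝ C]
    (U : Set C) (g : B → StrongDual ℝ C) (x : B) : ℝ :=
  sSup ((fun u => g x u) '' U)

theorem isLUB_worstCase {B C : Type*} [NormedAddCommGroup C] [NormedSpace ℝ C]
    {U : Set C} (hne : U.Nonempty) (hU : IsWeaklyCompact U) (g : B → StrongDual ℝ C) (x : B) :
    IsLUB ((fun u => g x u) '' U) (worstCase U g x) := by
  have hcont : Continuous fun w : WeakSpace ℝ C => g x ((toWeakSpace ℝ C).symm w) :=
    WeakBilin.eval_continuous (topDualPairing ℝ C).flip (g x)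
  have himg : (fun w : WeakSpace ℝ C => g x ((toWeakSpace ℝ C).symm w)) ''
      (toWeakSpace ℝ C '' U) = (fun u => g x u) '' U := by
    simp [Set.image_image]
  have hbdd : BddAbove ((fun u => g x u) '' U) := by
    rw [← himg]
    exact (IsCompact.image hU hcont).bddAbove
  exact isLUB_csSup (hne.image _) hbdd

/-- The feasible set `{x : sup_{u ∈ U i} g i (x, u) ≤ 0 for all i}` of the robust counterpart. -/
def robustFeasibleSet {m : ℕ} {B C : Type*} [NormedAddCommGroup C] [NormedSpace ℝ C]
    (U : Fin m → Set C) (g : Fin m → B → StrongDual ℝ C) : Set B :=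
  {x | ∀ i, worstCase (U i) (g i) x ≤ 0}

/-- `x` is a minimizer of the robust counterpart: it is feasible, and it minimizes `f` among all
feasible points. -/
def IsRobustMinimizer {m : ℕ} {B C : Type*} [NormedAddCommGroup C] [NormedSpace ℝ C]
    (f : B → ℝ) (U : Fin m → Set C) (g : Fin m → B → StrongDual ℝ C) (x : B) : Prop :=
  x ∈ robustFeasibleSet U g ∧ IsMinOn f (robustFeasibleSet U g) x

open Set Filter Topology

/-! Sufficiency is the subgradient inequality. For necessity, worst-case functions are convex, so
Slater's condition and a separation in `ι → ℝ` yield multipliers for which the worst-case Lagrangian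
stays above the optimal value (`exists_lagrange_multipliers`). The maximizing scenarios still depend
on `x`; since the Lagrangian is affine in the scenario and the scenario sets are weakly compact, a
minimax exchange finds one scenario serving all `x` (`exists_scenario_le_lagrangian`). The minimizer
of the program then minimizes the Lagrangian of that scenario: its value there forces complementary
slackness, and the sum rule splits the zero subgradient. -/

/-- **Gordan's alternative** for finitely many convex functions: if they are never simultaneously
negative on a nonempty set, some nontrivial nonnegative combination is nonnegative there. -/
theorem exists_nonneg_sum_mul_nonneg {E ι : Type*} [AddCommGroup E] [Module ℝ E] [Fintype ι]
    {S : Set E} (hS : S.Nonempty) {h : ι → E → ℝ} (hh : ∀ i, ConvexOn ℝ S (h i))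
    (hconv : Convex ℝ S) (H : ∀ x ∈ S, ∃ i, 0 ≤ h i x) :
    ∃ μ : ι → ℝ, (∀ i, 0 ≤ μ i) ∧ μ ≠ 0 ∧ ∀ x ∈ S, 0 ≤ ∑ i, μ i * h i x := by
  classical
  set A : Set (ι → ℝ) := {t | ∃ x ∈ S, ∀ i, h i x < t i} with hA
  have hAopen : IsOpen A := by
    have : A = ⋃ x ∈ S, Set.univ.pi fun i => Ioi (h i x) := by
      ext t; simp [hA]
    rw [this]
    exact isOpen_biUnion fun x _ => isOpen_set_pi finite_univ fun i _ => isOpen_Ioi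
  have hAconv : Convex ℝ A := by
    rintro s ⟨x, hx, hs⟩ t ⟨y, hy, ht⟩ a b ha hb hab
    refine ⟨a • x + b • y, hconv hx hy ha hb hab, fun i => ?_⟩
    exact ((hh i).convex_strict_epigraph (x := (x, s i)) ⟨hx, hs i⟩
      (y := (y, t i)) ⟨hy, ht i⟩ ha hb hab).2
  have h0 : (0 : ι → ℝ) ∉ A := by
    rintro ⟨x, hx, hlt⟩
    obtain ⟨i, hi⟩ := H x hx
    exact (hlt i).not_ge hi
  obtain ⟨φ, hφ⟩ := geometric_hahn_banach_point_open hAconv hAopen h0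
  rw [map_zero] at hφ
  have hφsum : ∀ t : ι → ℝ, φ t = ∑ i, φ (Pi.single i 1) * t i := fun t => by
    rw [← ContinuousLinearMap.coe_coe, LinearMap.pi_apply_eq_sum_univ]
    refine Finset.sum_congr rfl fun i _ => ?_
    rw [smul_eq_mul, mul_comm]
    congr 2
    ext j
    simp [Pi.single_apply, eq_comm]
  -- Separation only sees strict inequalities; letting `ε` decrease to `0` allows equality.
  have hφnonneg : ∀ x ∈ S, ∀ t : ι → ℝ, (∀ i, h i x ≤ t i) → 0 ≤ φ t := by
    intro x hx t ht
    have hlim : Tendsto (fun ε : ℝ => φ (t + ε • 1)) (𝓝[>] 0) (𝓝 (φ (t + (0 : ℝ) • 1))) :=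
      (Continuous.tendsto (by fun_prop) _).mono_left nhdsWithin_le_nhds
    rw [zero_smul, add_zero] at hlim
    refine ge_of_tendsto hlim ?_
    filter_upwards [self_mem_nhdsWithin] with ε hε
    refine (hφ _ ⟨x, hx, fun i => ?_⟩).le
    simpa using (ht i).trans_lt (lt_add_of_pos_right _ hε)
  obtain ⟨x₀, hx₀⟩ := hS
  refine ⟨fun i => φ (Pi.single i 1), fun i => ?_, fun hμ => ?_, fun x hx => ?_⟩
  · by_contra! hneg
    -- Raising coordinate `i` by this amount over `-φ (Pi.single i 1)` lowers `φ` by exactly this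
    -- amount, hence below zero.
    have hr : 0 ≤ |φ fun i => h i x₀| + 1 := by positivity
    have := hφnonneg x₀ hx₀
      ((fun i => h i x₀) + ((|φ fun i => h i x₀| + 1) / -φ (Pi.single i 1)) • Pi.single i 1)
      fun j => by
        have : (0 : ℝ) ≤ (Pi.single i 1 : ι → ℝ) j := by
          rw [Pi.single_apply]; split_ifs <;> norm_num
        simpa using mul_nonneg (div_nonneg hr (neg_pos.2 hneg).le) this
    rw [map_add, map_smul, smul_eq_mul, div_neg, neg_mul, div_mul_cancel₀ _ hneg.ne] at this
    linarith [le_abs_self (φ fun i => h i x₀)]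
  · have := hφ (fun i => h i x₀ + 1) ⟨x₀, hx₀, fun i => by simp⟩
    rw [hφsum] at this
    simp [fun i => congrFun hμ i] at this
  · rw [← hφsum fun i => h i x]
    exact hφnonneg x hx _ fun i => le_rfl

/-- **Lagrange multipliers** for a convex program satisfying the Slater condition. -/
theorem exists_lagrange_multipliers {E ι : Type*} [AddCommGroup E] [Module ℝ E] [Fintype ι]
    {f : E → ℝ} (hf : ConvexOn ℝ univ f) {G : ι → E → ℝ} (hG : ∀ i, ConvexOn ℝ univ (G i))
    {x₀ : E} (hx₀ : ∀ i, G i x₀ < 0) {v : ℝ} (hv : ∀ x, (∀ i, G i x ≤ 0) → v ≤ f x) :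
    ∃ l : ι → ℝ, (∀ i, 0 ≤ l i) ∧ ∀ x, v ≤ f x + ∑ i, l i * G i x := by
  -- The index `none` carries the objective gap `f - v`, the others the constraints.
  obtain ⟨μ, hμ, hμ0, hμs⟩ := exists_nonneg_sum_mul_nonneg (ι := Option ι) (S := univ)
    (univ_nonempty : (univ : Set E).Nonempty)
    (h := fun o => o.elim (fun x => f x - v) G)
    (by
      rintro (_ | i)
      · exact hf.sub (concaveOn_const v convex_univ)
      · exact hG i)
    convex_univ
    (fun x _ => by
      by_contra! hneg
      have := hv x fun i => (hneg (some i)).le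
      have := hneg none
      simp only [Option.elim_none] at this
      linarith)
  simp only [Fintype.sum_option, Option.elim_none, Option.elim_some, mem_univ,
    forall_true_left] at hμs
  -- Were the objective's weight zero, the Slater point would force all other weights to vanish too.
  rcases (hμ none).eq_or_lt with h0 | hpos
  · exfalso
    have hle : ∀ i ∈ Finset.univ, μ (some i) * G i x₀ ≤ 0 := fun i _ =>
      mul_nonpos_of_nonneg_of_nonpos (hμ _) (hx₀ i).le
    have hsum := hμs x₀
    rw [← h0, zero_mul, zero_add] at hsum
    have hz := (Finset.sum_eq_zero_iff_of_nonpos hle).1 (le_antisymm (Finset.sum_nonpos hle) hsum)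
    refine hμ0 (funext fun o => ?_)
    rcases o with _ | i
    · exact h0.symm
    · exact (mul_eq_zero.1 (hz i (Finset.mem_univ i))).resolve_right (hx₀ i).ne
  · refine ⟨fun i => μ (some i) / μ none, fun i => div_nonneg (hμ _) hpos.le, fun x => ?_⟩
    have hsum : ∑ i, μ (some i) / μ none * G i x = (∑ i, μ (some i) * G i x) / μ none := by
      rw [Finset.sum_div]
      exact Finset.sum_congr rfl fun i _ => by ring
    have := div_nonneg (hμs x) hpos.le
    rw [add_div, mul_div_cancel_left₀ _ hpos.ne'] at this
    linarith

/-! ### Minimax exchange -/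

/-- One-sided form of Sion's minimax theorem, without compactness or attainment in `Y`. -/
theorem exists_forall_le_of_forall_exists_le {E F : Type*}
    [TopologicalSpace E] [AddCommGroup E] [Module ℝ E] [IsTopologicalAddGroup E]
    [ContinuousSMul ℝ E]
    [TopologicalSpace F] [AddCommGroup F] [Module ℝ F] [IsTopologicalAddGroup F]
    [ContinuousSMul ℝ F]
    {X : Set E} {Y : Set F} {f : E → F → ℝ} (ne_X : X.Nonempty) (kX : IsCompact X)
    (cX : Convex ℝ X) (cY : Convex ℝ Y)
    (hfy : ∀ y ∈ Y, LowerSemicontinuousOn (fun x => f x y) X)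
    (hfy' : ∀ y ∈ Y, QuasiconvexOn ℝ X fun x => f x y)
    (hfx : ∀ x ∈ X, UpperSemicontinuousOn (fun y => f x y) Y)
    (hfx' : ∀ x ∈ X, QuasiconcaveOn ℝ Y fun y => f x y)
    {t : ℝ} (ht : ∀ y ∈ Y, ∃ x ∈ X, f x y ≤ t) :
    ∃ x ∈ X, ∀ y ∈ Y, f x y ≤ t := by
  by_contra! hne
  -- By compactness, finitely many `y` already exclude every `x`; Sion's finite step then replaces
  -- them by a single `y`, against `ht`.
  obtain ⟨s, hs⟩ : ∃ s : Finset Y, ∀ x ∈ X, ∃ i ∈ s, t < f x i := by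
    rw [← LowerSemicontinuousOn.inter_biInter_preimage_Iic_eq_empty_iff_exists_finset kX hfy]
    refine eq_empty_of_forall_notMem ?_
    rintro x ⟨hx, hx'⟩
    simp only [mem_iInter, mem_preimage, mem_Iic] at hx'
    obtain ⟨y, hy, hlt⟩ := hne x hx
    exact hlt.not_ge (hx' y hy)
  obtain ⟨y, hy, hlt⟩ := Sion.exists_lt_iInf_of_lt_iInf_of_finite ne_X kX hfy hfy' cY hfx hfx' cX
    (toFinite _) (Subtype.coe_image_subset Y ↑s) (t := t) fun x hx => by
      obtain ⟨i, hi, hi'⟩ := hs x hx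
      exact ⟨i, mem_image_of_mem _ hi, hi'⟩
  obtain ⟨x, hx, hle⟩ := ht y hy
  exact (hlt x hx).not_ge hle

/-! ### Subdifferential calculus -/

section Subdifferential

variable {E : Type*} [NormedAddCommGroup E] [NormedSpace ℝ E]

/-- Minimality makes the strict epigraph of `h`, open by continuity, disjoint from the hypograph of
`f x + h x - f`. A separating hyperplane is not vertical, and its slope is the subgradient. Both
nonemptiness and the sum rule follow from this. -/
theorem exists_mem_fenchelSubdifferential_of_isMinOn_add {S : Set E} {f h : E → ℝ}
    (hf : ConvexOn ℝ S f) (hh : ConvexOn ℝ univ h) (hc : Continuous h) {x : E} (hx : x ∈ S)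
    (hmin : IsMinOn (fun y => f y + h y) S x) :
    ∃ p ∈ fenchelSubdifferential h x, ∀ y ∈ S, f x - p (y - x) ≤ f y := by
  have hT : Convex ℝ {q : E × ℝ | q.1 ∈ S ∧ q.2 ≤ (f x + h x) - f q.1} :=
    ((concaveOn_const (f x + h x) hf.1).sub hf).convex_hypograph
  have hAo : IsOpen {q : E × ℝ | q.1 ∈ univ ∧ h q.1 < q.2} := by
    simpa using isOpen_lt (hc.comp continuous_fst) continuous_snd
  obtain ⟨φ, u, hA, hB⟩ := geometric_hahn_banach_open hh.convex_strict_epigraph hAo hT (by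
    rw [disjoint_left]
    rintro ⟨y, r⟩ ⟨-, h1⟩ ⟨hy, h2⟩
    have h3 : f x + h x ≤ f y + h y := hmin hy
    simp only at h1 h2
    linarith)
  have hsplit : ∀ (y : E) (r : ℝ), φ (y, r) = φ (y, 0) + φ (0, 1) * r := fun y r => by
    have : (y, r) = (y, (0 : ℝ)) + r • ((0 : E), (1 : ℝ)) := by simp
    rw [this, map_add, map_smul, smul_eq_mul, mul_comm]
  set c := φ (0, 1) with hcdef
  have hBx : u ≤ φ (x, 0) + c * h x := by
    have := hB (x, h x) ⟨hx, by simp⟩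
    rwa [hsplit] at this
  -- The point one unit above the graph at `x` lies strictly on the other side from `(x, h x)`.
  have hcneg : c < 0 := by
    have := hA (x, h x + 1) ⟨mem_univ _, by simp⟩
    rw [hsplit] at this
    linarith
  have hAle : ∀ y, φ (y, 0) + c * h y ≤ u := fun y => by
    have hlim : Tendsto (fun r : ℝ => φ (y, 0) + c * r) (𝓝[>] (h y))
        (𝓝 (φ (y, 0) + c * h y)) :=
      (Continuous.tendsto (by fun_prop) _).mono_left nhdsWithin_le_nhds
    refine le_of_tendsto hlim ?_
    filter_upwards [self_mem_nhdsWithin] with r hr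
    rw [← hsplit]
    exact (hA (y, r) ⟨mem_univ _, hr⟩).le
  have hlin : ∀ y, φ (y - x, 0) = φ (y, 0) - φ (x, 0) := fun y => by
    rw [← map_sub]; simp
  refine ⟨-c⁻¹ • φ.comp (ContinuousLinearMap.inl ℝ E ℝ), fun y => ?_, fun y hy => ?_⟩
  · have h1 : φ (y - x, 0) ≤ (-c) * (h y - h x) := by
      rw [hlin]; linarith [hAle y]
    have h2 : (-c)⁻¹ * φ (y - x, 0) ≤ h y - h x := by
      rwa [inv_mul_le_iff₀ (neg_pos.2 hcneg)]
    rw [inv_neg] at h2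
    simp only [smul_apply, ContinuousLinearMap.comp_apply,
      ContinuousLinearMap.inl_apply, smul_eq_mul]
    linarith
  · have h0 := hB (y, f x + h x - f y) ⟨hy, le_rfl⟩
    rw [hsplit] at h0
    have h1 : (-c) * (f x - f y) ≤ φ (y - x, 0) := by
      rw [hlin]; linarith [hAle x]
    have h2 : f x - f y ≤ (-c)⁻¹ * φ (y - x, 0) := by
      rwa [le_inv_mul_iff₀ (neg_pos.2 hcneg)]
    rw [inv_neg] at h2
    simp only [smul_apply, ContinuousLinearMap.comp_apply,
      ContinuousLinearMap.inl_apply, smul_eq_mul]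
    linarith

theorem fenchelSubdifferential_nonempty {h : E → ℝ} (hh : ConvexOn ℝ univ h) (hc : Continuous h)
    (x : E) : (fenchelSubdifferential h x).Nonempty := by
  obtain ⟨p, hp, -⟩ := exists_mem_fenchelSubdifferential_of_isMinOn_add
    (convexOn_const (0 : ℝ) (convex_singleton x)) hh hc (mem_singleton x)
    (isMinOn_iff.2 fun y hy => by rw [mem_singleton_iff.1 hy])
  exact ⟨p, hp⟩

/-- The **Moreau–Rockafellar sum rule**. -/
theorem fenchelSubdifferential_add_subset {f h : E → ℝ} (hf : ConvexOn ℝ univ f)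
    (hh : ConvexOn ℝ univ h) (hc : Continuous h) (x : E) :
    fenchelSubdifferential (fun y => f y + h y) x ⊆
      fenchelSubdifferential f x + fenchelSubdifferential h x := by
  intro s hs
  obtain ⟨p, hp, hle⟩ := exists_mem_fenchelSubdifferential_of_isMinOn_add (x := x)
    (hf.sub ((s : E →ₗ[ℝ] ℝ).concaveOn convex_univ)) hh hc (mem_univ x) (fun y _ => by
      have := hs y
      rw [map_sub] at this
      change f x - s x + h x ≤ f y - s y + h y
      linarith)
  refine ⟨s - p, fun y => ?_, p, hp, sub_add_cancel s p⟩
  have := hle y (mem_univ y)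
  change f x - s x - p (y - x) ≤ f y - s y at this
  rw [sub_apply, map_sub s]
  linarith

theorem fenchelSubdifferential_const_mul_subset {h : E → ℝ} (hh : ConvexOn ℝ univ h)
    (hc : Continuous h) {c : ℝ} (hc0 : 0 ≤ c) (x : E) :
    fenchelSubdifferential (fun y => c * h y) x ⊆ c • fenchelSubdifferential h x := by
  intro s hs
  -- For `c = 0` the right side is `{0}` only because the subdifferential is nonempty.
  rcases hc0.eq_or_lt with rfl | hpos
  · obtain ⟨p, hp⟩ := fenchelSubdifferential_nonempty hh hc x
    refine ⟨p, hp, ?_⟩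
    ext y
    have h1 := hs (x + y)
    have h2 := hs (x - y)
    simp only [zero_mul, zero_add, add_sub_cancel_left, sub_sub_cancel_left, map_neg] at h1 h2
    simp only [zero_smul, zero_apply]
    linarith
  · refine ⟨c⁻¹ • s, fun y => ?_, smul_inv_smul₀ hpos.ne' s⟩
    have h1 : s (y - x) ≤ c * (h y - h x) := by linarith [hs y]
    have h2 : c⁻¹ * s (y - x) ≤ h y - h x := by rwa [inv_mul_le_iff₀ hpos]
    rw [smul_apply, smul_eq_mul]
    linarith

/-- Each term is absorbed into `f`, which the sum rule does not require to be continuous; hence the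
induction over all convex `f`. -/
theorem fenchelSubdifferential_add_sum_subset {ι : Type*} (t : Finset ι) {f : E → ℝ}
    {h : ι → E → ℝ} (hf : ConvexOn ℝ univ f) (hh : ∀ i, ConvexOn ℝ univ (h i))
    (hc : ∀ i, Continuous (h i)) {l : ι → ℝ} (hl : ∀ i, 0 ≤ l i) (x : E) :
    fenchelSubdifferential (fun y => f y + ∑ i ∈ t, l i * h i y) x ⊆
      fenchelSubdifferential f x + ∑ i ∈ t, l i • fenchelSubdifferential (h i) x := by
  classical
  induction t using Finset.induction_on generalizing f with
  | empty => simp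
  | insert a t ha ih =>
    have hconv : ConvexOn ℝ univ fun y => l a * h a y := (hh a).smul (hl a)
    have key := ih (f := fun y => f y + l a * h a y) (hf.add hconv)
    simp only [Finset.sum_insert ha, ← add_assoc]
    refine key.trans (Set.add_subset_add_right ?_)
    refine (fenchelSubdifferential_add_subset hf hconv ((hc a).const_mul _) x).trans ?_
    exact Set.add_subset_add_left (fenchelSubdifferential_const_mul_subset (hh a) (hc a) (hl a) x)

end Subdifferential

/-! ### Worst-case functions and the choice of one scenario -/

section WorstCase

variable {B C : Type*} [NormedAddCommGroup C] [NormedSpace ℝ C]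

theorem le_worstCase {U : Set C} (hU : IsWeaklyCompact U) (g : B → StrongDual ℝ C) (x : B)
    {u : C} (hu : u ∈ U) : g x u ≤ worstCase U g x :=
  (isLUB_worstCase ⟨u, hu⟩ hU g x).1 (mem_image_of_mem _ hu)

theorem continuous_weakSpace_eval (φ : StrongDual ℝ C) :
    Continuous fun w : WeakSpace ℝ C => φ ((toWeakSpace ℝ C).symm w) :=
  WeakBilin.eval_continuous (topDualPairing ℝ C).flip φ

theorem exists_eq_worstCase {U : Set C} (hne : U.Nonempty) (hU : IsWeaklyCompact U)
    (g : B → StrongDual ℝ C) (x : B) : ∃ u ∈ U, g x u = worstCase U g x := by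
  obtain ⟨_, ⟨u, hu, rfl⟩, hmax⟩ := IsCompact.exists_isMaxOn hU (hne.image _)
    (continuous_weakSpace_eval (g x)).continuousOn
  refine ⟨u, hu, le_antisymm (le_worstCase hU g x hu) ((isLUB_worstCase hne hU g x).2 ?_)⟩
  rintro _ ⟨w, hw, rfl⟩
  simpa using hmax (mem_image_of_mem _ hw)

theorem convexOn_worstCase [AddCommGroup B] [Module ℝ B] {U : Set C} (hne : U.Nonempty)
    (hU : IsWeaklyCompact U) {g : B → StrongDual ℝ C}
    (hg : ∀ u ∈ U, ConvexOn ℝ univ fun x => g x u) : ConvexOn ℝ univ (worstCase U g) := by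
  refine ⟨convex_univ, fun x _ y _ a b ha hb hab => (isLUB_worstCase hne hU g _).2 ?_⟩
  rintro _ ⟨u, hu, rfl⟩
  refine ((hg u hu).2 (mem_univ x) (mem_univ y) ha hb hab).trans ?_
  exact add_le_add (mul_le_mul_of_nonneg_left (le_worstCase hU g x hu) ha)
    (mul_le_mul_of_nonneg_left (le_worstCase hU g y hu) hb)

/-- If the Lagrangian with worst-case constraints is bounded below by `v`, a single scenario
already gives that bound. -/
theorem exists_scenario_le_lagrangian {ι : Type*} [Fintype ι]
    [NormedAddCommGroup B] [NormedSpace ℝ B]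
    {f : B → ℝ} (hf : ConvexOn ℝ univ f) (hf_lsc : LowerSemicontinuous f)
    {U : ι → Set C} (hU_ne : ∀ i, (U i).Nonempty) (hU_conv : ∀ i, Convex ℝ (U i))
    (hU_comp : ∀ i, IsWeaklyCompact (U i)) {g : ι → B → StrongDual ℝ C}
    (hg_conv : ∀ i, ∀ u ∈ U i, ConvexOn ℝ univ fun x => g i x u)
    (hg_cont : ∀ i, ∀ u ∈ U i, Continuous fun x => g i x u)
    {l : ι → ℝ} (hl : ∀ i, 0 ≤ l i) {v : ℝ}
    (hv : ∀ x, v ≤ f x + ∑ i, l i * worstCase (U i) (g i) x) :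
    ∃ u ∈ univ.pi U, ∀ x, v ≤ f x + ∑ i, l i * g i x (u i) := by
  let e := (toWeakSpace ℝ C).symm
  -- The sign is reversed because the minimax lemma picks its point by minimizing over the compact
  -- side, here the weakly compact product of scenario sets.
  let L : (ι → WeakSpace ℝ C) → B → ℝ := fun w x => -f x - ∑ i, l i * g i x (e (w i))
  have hmem : ∀ w ∈ univ.pi fun i => toWeakSpace ℝ C '' U i, ∀ i, e (w i) ∈ U i := by
    intro w hw i
    obtain ⟨u, hu, hui⟩ := hw i (mem_univ i)
    rw [← hui]
    simpa [e] using hu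
  have hsum_conv : ∀ w ∈ univ.pi fun i => toWeakSpace ℝ C '' U i,
      ConvexOn ℝ univ fun x => ∑ i, l i * g i x (e (w i)) := fun w hw => by
    have := Finset.sum_induction (s := Finset.univ) (fun i x => l i * g i x (e (w i)))
      (ConvexOn ℝ univ) (fun _ _ => ConvexOn.add) (convexOn_const 0 convex_univ)
      fun i _ => (hg_conv i _ (hmem w hw i)).smul (hl i)
    simpa [Finset.sum_fn] using this
  obtain ⟨w, hw, hle⟩ := exists_forall_le_of_forall_exists_le
    (X := univ.pi fun i => toWeakSpace ℝ C '' U i) (Y := (univ : Set B)) (f := L) (t := -v)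
    (univ_pi_nonempty_iff.2 fun i => (hU_ne i).image _) (isCompact_univ_pi hU_comp)
    (convex_pi fun i _ => (hU_conv i).linear_image (toWeakSpace ℝ C).toLinearMap) convex_univ
    (fun x _ => by
      refine Continuous.lowerSemicontinuous ?_ |>.lowerSemicontinuousOn _
      refine continuous_const.sub (continuous_finsetSum _ fun i _ => continuous_const.mul ?_)
      exact (continuous_weakSpace_eval (g i x)).comp (continuous_apply i))
    (fun x _ => by
      refine ConvexOn.quasiconvexOn ⟨convex_pi fun i _ =>
        (hU_conv i).linear_image (toWeakSpace ℝ C).toLinearMap, ?_⟩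
      intro w _ w' _ a b _ _ hab
      -- `L` is affine in the scenario, so convexity holds with equality.
      refine le_of_eq ?_
      have : f x = a * f x + b * f x := by rw [← add_mul, hab, one_mul]
      simp only [L, Pi.add_apply, Pi.smul_apply, map_add, map_smul, smul_eq_mul, mul_add,
        Finset.sum_add_distrib, mul_sub, Finset.mul_sum, mul_left_comm (l _)]
      linarith)
    (fun w hw => by
      have h1 : LowerSemicontinuous fun x => f x + ∑ i, l i * g i x (e (w i)) :=
        hf_lsc.add (Continuous.lowerSemicontinuous
          (continuous_finsetSum _ fun i _ => continuous_const.mul (hg_cont i _ (hmem w hw i))))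
      intro x _ y hy
      have := h1 x (-y) (by simp only [L] at hy; linarith)
      filter_upwards [nhdsWithin_le_nhds this] with z hz
      simp only [L]
      linarith)
    (fun w hw => (hf.neg.sub (hsum_conv w hw)).quasiconcaveOn)
    (fun x _ => by
      choose u hu hmax using fun i => exists_eq_worstCase (hU_ne i) (hU_comp i) (g i) x
      refine ⟨fun i => toWeakSpace ℝ C (u i), fun i _ => mem_image_of_mem _ (hu i), ?_⟩
      have := hv x
      simp only [L, e, LinearEquiv.symm_apply_apply, hmax]
      linarith)
  refine ⟨fun i => e (w i), fun i _ => hmem w hw i, fun x => ?_⟩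
  have := hle x (mem_univ x)
  simp only [L] at this
  linarith

end WorstCase

/-! ### Optimality conditions -/

theorem mainTheorem5
    {B : Type*} [NormedAddCommGroup B] [NormedSpace ℝ B] [CompleteSpace B]
    {C : Type*} [NormedAddCommGroup C] [NormedSpace ℝ C] [CompleteSpace C]
    {m : ℕ} (f : B → ℝ) (hf_conv : ConvexOn ℝ Set.univ f) (hf_lsc : LowerSemicontinuous f)
    (U : Fin m → Set C) (hU_ne : ∀ i, (U i).Nonempty) (hU_conv : ∀ i, Convex ℝ (U i))
    (hU_comp : ∀ i, IsWeaklyCompact (U i))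
    (g : Fin m → B → StrongDual ℝ C)
    (hg_conv : ∀ i, ∀ u ∈ U i, ConvexOn ℝ Set.univ (fun x => g i x u))
    (hg_cont : ∀ i, ∀ u ∈ U i, Continuous (fun x => g i x u))
    (hSlater : ∃ x₀ : B, ∀ i, worstCase (U i) (g i) x₀ < 0)
    (xbar : B) :
    IsRobustMinimizer f U g xbar ↔
      ∃ (lam : Fin m → ℝ) (u : Fin m → C),
        (∀ i, 0 ≤ lam i) ∧ u ∈ Set.univ.pi U ∧
        (∀ i, worstCase (U i) (g i) xbar ≤ 0) ∧
        (0 : StrongDual ℝ B) ∈ fenchelSubdifferential f xbar +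
          ∑ i, lam i • fenchelSubdifferential (fun x => g i x (u i)) xbar ∧
        (∀ i, lam i * g i xbar (u i) = 0) := by
  constructor
  · rintro ⟨hfeas, hmin⟩
    obtain ⟨x₀, hx₀⟩ := hSlater
    obtain ⟨l, hl, hlv⟩ := exists_lagrange_multipliers hf_conv
      (fun i => convexOn_worstCase (hU_ne i) (hU_comp i) (hg_conv i)) hx₀ (v := f xbar)
      fun x hx => hmin hx
    obtain ⟨u, hu, huv⟩ := exists_scenario_le_lagrangian hf_conv hf_lsc hU_ne hU_conv hU_comp
      hg_conv hg_cont hl hlv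
    have hui : ∀ i, u i ∈ U i := fun i => hu i (mem_univ i)
    have hnonpos : ∀ i ∈ Finset.univ, l i * g i xbar (u i) ≤ 0 := fun i _ =>
      mul_nonpos_of_nonneg_of_nonpos (hl i) ((le_worstCase (hU_comp i) _ _ (hui i)).trans (hfeas i))
    -- At `xbar` the Lagrangian is at least `f xbar`, so a sum of nonpositive terms is nonnegative
    -- and every term vanishes.
    have hsum : ∑ i, l i * g i xbar (u i) = 0 :=
      le_antisymm (Finset.sum_nonpos hnonpos) (by linarith [huv xbar])
    refine ⟨l, u, hl, hu, hfeas, ?_, fun i =>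
      (Finset.sum_eq_zero_iff_of_nonpos hnonpos).1 hsum i (Finset.mem_univ i)⟩
    refine fenchelSubdifferential_add_sum_subset Finset.univ hf_conv
      (fun i => hg_conv i _ (hui i)) (fun i => hg_cont i _ (hui i)) hl xbar fun y => ?_
    simpa [hsum] using huv y
  · rintro ⟨l, u, hl, hu, hfeas, ⟨s, hs, r, hr, hsr⟩, hcompl⟩
    refine ⟨hfeas, fun y hy => ?_⟩
    obtain ⟨q, hq, rfl⟩ := (Set.mem_finsetSum _ _ _).1 hr
    -- By complementary slackness `q i (y - xbar) ≤ l i * g i y (u i)`, which is nonpositive at a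
    -- feasible `y`.
    have hle : ∀ i, q i (y - xbar) ≤ 0 := fun i => by
      obtain ⟨p, hp, hpq⟩ := hq (Finset.mem_univ i)
      have h1 := mul_le_mul_of_nonneg_left (hp y) (hl i)
      have h2 : l i * g i y (u i) ≤ 0 := mul_nonpos_of_nonneg_of_nonpos (hl i)
        ((le_worstCase (hU_comp i) _ _ (hu i (mem_univ i))).trans (hy i))
      rw [mul_add, hcompl i, zero_add] at h1
      simp only [← hpq, smul_apply, smul_eq_mul]
      exact h1.trans h2
    have h0 : s (y - xbar) + ∑ i, q i (y - xbar) = 0 := by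
      simpa [sum_apply] using congrArg (fun φ => φ (y - xbar)) hsr
    have hq0 : ∑ i, q i (y - xbar) ≤ 0 := Finset.sum_nonpos fun i _ => hle i
    have := hs y
    change f xbar ≤ f y
    linarith
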